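/- Let $n\ge 2$, let $\bar{\mathbb S}^n_+=\{y\in\mathbb S^n\subset\mathbb R^{n+1}: y_{n+1}\ge 0\}$ be the closed unit hemisphere with its round metric $\sigma$ and covariant derivative $\nabla$, let $\mathbb S^n_+=\{y\in\mathbb S^n:y_{n+1}>0\}$, and let $\varphi\in[0,\frac{\pi}{2}]$ be the polar angle, $y_{n+1}=\cos\varphi$. Let $T\in(0,\infty]$ and let $\gamma:\bar{\mathbb S}^n_+\times[0,T)\to\mathbb R$ be a solution of $$\partial_t\gamma=\frac{1}{\rho v e^{w}}\Big(\sigma^{ij}-\frac{\gamma^i\gamma^j}{v^2}\Big)\gamma_{ij}+\frac{n\sin\varphi\,\gamma_\varphi}{v}-\frac{n(\rho^2-1)|\nabla\gamma|^2}{2\rho v}\quad\text{in }\mathbb S^n_+\times(0,T),$$ $$\partial_\varphi\gamma=0\ \text{ on }\partial\mathbb S^n_+\times(0,T),\qquad \gamma(\cdot,0)=\gamma_0,$$ where $\rho=e^{\gamma}$, $v=\sqrt{1+|\nabla\gamma|^2}$, $e^{w}=\frac{2}{1+\rho^2+2\rho\cos\varphi}$, and indices denote covariant derivatives. Here $\gamma$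 is of class $C^3$ on $\bar{\mathbb S}^n_+\times(0,T)$ (for instance smooth), $\gamma(\cdot,t)$ is of class $C^1$ on $\bar{\mathbb S}^n_+$ for every $t\in[0,T)$, and $\gamma$ and $\nabla\gamma$ are continuous on $\bar{\mathbb S}^n_+\times[0,T)$. Then there is a constant $C$, depending only on $n$, $\|\gamma_0\|_{C^1(\bar{\mathbb S}^n_+)}$ and $\min_{\bar{\mathbb S}^n_+}\gamma_0$, such that $$|\nabla\gamma|^2\le C\quad\text{on }\bar{\mathbb S}^n_+\times[0,T).$$ Moreover, if $n\ge 3$, there are constants $C_1$ and $C_2>0$, depending only on $n$, $\|\gamma_0\|_{C^1(\bar{\mathbb S}^n_+)}$ and $\min_{\bar{\mathbb S}^n_+}\gamma_0$, such that $$|\nabla\gamma|^2\le C_1e^{-C_2t}\quad\text{on }\bar{\mathbb S}^n_+\times[0,T).$$ -/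

import Mathlib

noncomputable section

namespace GuanLiFlow

/-- The ambient Euclidean space `ℝ^{n+1}`; the coordinate `Fin.last n` is the vertical one. -/
abbrev Ambient (n : ℕ) : Type := EuclideanSpace ℝ (Fin (n + 1))

/-- The north pole `E_{n+1}`. -/
def northPole (n : ℕ) : Ambient n := EuclideanSpace.single (Fin.last n) 1

/-- The closed upper unit hemisphere; for `y` in it, `y (Fin.last n) = cos φ`, where
`φ ∈ [0, π/2]` is the polar angle. -/
def hemisphere (n : ℕ) : Set (Ambient n) := {y | ‖y‖ = 1 ∧ 0 ≤ y (Fin.last n)}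

/-- The cone over the closed hemisphere: the closed upper half-space without the origin. -/
def cone (n : ℕ) : Set (Ambient n) := {z | z ≠ 0 ∧ 0 ≤ z (Fin.last n)}

/-- The extension of a function on the hemisphere to the cone which is constant along rays.
Only the values of `f` on the hemisphere matter on the cone. -/
def radialExt {n : ℕ} (f : Ambient n → ℝ) : Ambient n → ℝ := fun z => f (‖z‖⁻¹ • z)

/-- At a point `y` of the hemisphere this is the gradient `∇f(y)` with respect to the round metric
(one-sided at the boundary), as a vector of `ℝ^{n+1}` tangent to the sphere: the Euclidean gradient
of the extension that is constant along rays. -/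
def sphereGrad {n : ℕ} (f : Ambient n → ℝ) (z : Ambient n) : Ambient n :=
  gradientWithin (radialExt f) (cone n) z

/-- Orthogonal projection onto the tangent space of the unit sphere at `y`. -/
def tangentProj {n : ℕ} (y X : Ambient n) : Ambient n := X - inner ℝ y X • y

/-- The covariant Hessian `∇²f(X, Y) = ⟨∇_X ∇f, Y⟩` of the round metric at `y`. The Levi-Civita
connection of the sphere is the tangential part of the Euclidean derivative; general vectors `X`,
`Y` are first projected to the tangent space at `y`. -/
def sphereHess {n : ℕ} (f : Ambient n → ℝ) (y X Y : Ambient n) : ℝ :=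
  inner ℝ (fderivWithin ℝ (sphereGrad f) (cone n) y (tangentProj y X)) (tangentProj y Y)

/-- The Laplacian of the round metric: the trace of the covariant Hessian over the tangent space
(the Hessian vanishes in the normal direction, so the trace is taken in an orthonormal basis of the
ambient space). -/
def sphereLaplacian {n : ℕ} (f : Ambient n → ℝ) (y : Ambient n) : ℝ :=
  ∑ i : Fin (n + 1), sphereHess f y (EuclideanSpace.single i 1) (EuclideanSpace.single i 1)

/-- The vector field `sin φ ∂_φ = cos φ • y - E_{n+1}` on the hemisphere. It is smooth also at the
pole, and at boundary points (`φ = π/2`) it equals `∂_φ`, the outward unit conormal. -/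
def sinPhiDPhi {n : ℕ} (y : Ambient n) : Ambient n := y (Fin.last n) • y - northPole n

/-- The conformal factor `e^w = 2 / (1 + ρ² + 2 ρ cos φ)`. -/
def expW {n : ℕ} (ρ : ℝ) (y : Ambient n) : ℝ := 2 / (1 + ρ ^ 2 + 2 * ρ * y (Fin.last n))

/-- The right-hand side of the scalar flow, with `ρ = e^f` and `v = √(1 + |∇f|²)`:
`(1/(ρ v e^w)) (σ^{ij} - f^i f^j / v²) f_{ij} + n sin φ f_φ / v - n (ρ² - 1) |∇f|² / (2 ρ v)`. -/
def flowRHS {n : ℕ} (f : Ambient n → ℝ) (y : Ambient n) : ℝ :=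
  let ρ : ℝ := Real.exp (f y)
  let p : Ambient n := sphereGrad f y
  let v : ℝ := Real.sqrt (1 + ‖p‖ ^ 2)
  1 / (ρ * v * expW ρ y) * (sphereLaplacian f y - sphereHess f y p p / v ^ 2)
    + n * inner ℝ (sinPhiDPhi y) p / v
    - n * (ρ ^ 2 - 1) * ‖p‖ ^ 2 / (2 * ρ * v)

/-- The half-open time interval `[0, T)`, where `T = ∞` is allowed. -/
def timeInterval (T : EReal) : Set ℝ := {t | 0 ≤ t ∧ (t : EReal) < T}

/-- The open time interval `(0, T)`, where `T = ∞` is allowed. -/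
def openTimeInterval (T : EReal) : Set ℝ := {t | 0 < t ∧ (t : EReal) < T}

/-- `γ` is a classical solution on `[0, T)` of the scalar flow with Neumann boundary condition;
its initial value is `γ 0`. The solution is of class `C³` in space and time up to the boundary of
the hemisphere for positive times, and `C¹` in space, continuously up to the initial time. -/
structure IsFlowSolution (n : ℕ) (T : EReal) (γ : ℝ → Ambient n → ℝ) : Prop where
  /-- Regularity, up to the boundary of the hemisphere, for positive times. -/
  contDiffOn : ContDiffOn ℝ 3 (fun q : ℝ × Ambient n => radialExt (γ q.1) q.2)
    (openTimeInterval T ×ˢ cone n)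
  /-- The initial function is of class `C¹` up to the boundary. -/
  contDiffOn_zero : ContDiffOn ℝ 1 (radialExt (γ 0)) (cone n)
  /-- The solution is continuous up to the initial time. -/
  continuousOn : ContinuousOn (fun q : ℝ × Ambient n => γ q.1 q.2)
    (timeInterval T ×ˢ hemisphere n)
  /-- The spatial gradient is continuous up to the initial time. -/
  continuousOn_grad : ContinuousOn (fun q : ℝ × Ambient n => sphereGrad (γ q.1) q.2)
    (timeInterval T ×ˢ hemisphere n)
  /-- The equation, in the open hemisphere and for positive times. -/
  equation : ∀ t ∈ openTimeInterval T, ∀ y ∈ hemisphere n, 0 < y (Fin.last n) →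
    deriv (fun s => γ s y) t = flowRHS (γ t) y
  /-- The Neumann condition `∂_φ γ = 0` on the boundary of the hemisphere. -/
  neumann : ∀ t ∈ openTimeInterval T, ∀ y ∈ hemisphere n, y (Fin.last n) = 0 →
    inner ℝ (sinPhiDPhi y) (sphereGrad (γ t) y) = 0

/-- The `C¹` norm `sup |f| + sup |∇f|` on the closed hemisphere. -/
def c1Norm {n : ℕ} (f : Ambient n → ℝ) : ℝ :=
  sSup ((fun y => |f y|) '' hemisphere n) + sSup ((fun y => ‖sphereGrad f y‖) '' hemisphere n)

/-- The minimum of a continuous function on the closed (compact) hemisphere. -/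
def minOn {n : ℕ} (f : Ambient n → ℝ) : ℝ := sInf (f '' hemisphere n)

end GuanLiFlow

end

namespace GuanLiFlow

open Set Filter Topology

/-! The proof applies the maximum principle to `p = |∇γ|²` itself. Extending γ to be constant along
rays turns covariant calculus on the sphere into calculus on a half-space without the origin, where
third derivatives commute; the curvature of the sphere reappears through the radial identities
`hessWithin_radial` and `thirdWithin_radial`.

Write `g = ∇γ`, `H` for the derivative of `g` along the cone, and `u = cos φ`. Multiplied by `v`,
the equation reads `v γ_t = (cosh γ + u)(tr H - ⟨Hg, g⟩/v²) - n(g_{n+1} + sinh γ · p)`. At a spatial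
maximum of `p` at a point `y`, `Hg = -p y` and the second derivatives of `p` along great circles are
nonpositive. This also holds on the boundary: by the Neumann condition and the total geodesy of the
equator, the conormal derivative of `p` vanishes there. As `v` is stationary as well,
differentiating the equation along `g` gives `v p_t / 2` (`time_deriv_le_of_max`).

In the result, `trace_estimate` supplies the good terms `-(n-1)p - K` with `(tr H)² ≤ (n-1)K`, and
`reaction_le` absorbs the single term linear in `tr H` by Young's inequality. What remains is `v p_t
≤ -((n-1) + u(n-3)) p`. The coefficient is nonnegative for `n = 2`, where it equals `1 - u`, and at
least 2 for `n ≥ 3`; hence boundedness and exponential decay respectively. No bound on γ enters,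
because `cosh γ` is only used through `cosh γ ≥ 1`. -/

lemma hasFDerivWithinAt_inner_const {E : Type*} [NormedAddCommGroup E] [InnerProductSpace ℝ E]
    {G : Type*} [NormedAddCommGroup G] [NormedSpace ℝ G]
    {S : Set G} {w : G} {V : G → E} {V' : G →L[ℝ] E} (h : HasFDerivWithinAt V V' S w) (Y : E) :
    HasFDerivWithinAt (fun x => inner ℝ (V x) Y) ((innerSL ℝ Y).comp V') S w := by
  have := ((innerSL ℝ Y).hasFDerivAt (x := V w)).comp_hasFDerivWithinAt w h
  refine this.congr (fun x _ => ?_) ?_ <;> simp [real_inner_comm]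

lemma hasFDerivWithinAt_apply_const {E : Type*} [NormedAddCommGroup E] [NormedSpace ℝ E]
    {G : Type*} [NormedAddCommGroup G] [NormedSpace ℝ G]
    {S : Set G} {w : G} {F : Type*} [NormedAddCommGroup F] [NormedSpace ℝ F]
    {V : G → E →L[ℝ] F} {V' : G →L[ℝ] E →L[ℝ] F} (h : HasFDerivWithinAt V V' S w) (Y : E) :
    HasFDerivWithinAt (fun x => V x Y) (V'.flip Y) S w := by
  simpa using h.clm_apply (hasFDerivWithinAt_const Y w S)

/-! ### Gradient, Hessian and third derivative up to the boundary of a set. -/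

section Calculus

variable {E : Type*} [NormedAddCommGroup E] [InnerProductSpace ℝ E] [CompleteSpace E]
variable {K : Set E} {f : E → ℝ} {z : E}

lemma inner_gradientWithin (X : E) :
    inner ℝ (gradientWithin f K z) X = fderivWithin ℝ f K z X := by
  simp [gradientWithin]

lemma contDiffOn_gradientWithin {m k : WithTop ℕ∞} (hK : UniqueDiffOn ℝ K)
    (hf : ContDiffOn ℝ k f K) (h : m + 1 ≤ k) : ContDiffOn ℝ m (gradientWithin f K) K :=
  (InnerProductSpace.toDual ℝ E).symm.toContinuousLinearEquiv.contDiff.comp_contDiffOn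
    (hf.fderivWithin hK h)

/-- The second derivative of a function is the derivative of its gradient. -/
lemma inner_fderivWithin_gradientWithin (hK : UniqueDiffOn ℝ K) (hf : ContDiffOn ℝ 2 f K)
    (hz : z ∈ K) (X Y : E) :
    inner ℝ (fderivWithin ℝ (gradientWithin f K) K z X) Y
      = fderivWithin ℝ (fderivWithin ℝ f K) K z X Y := by
  have hd : DifferentiableWithinAt ℝ (fderivWithin ℝ f K) K z :=
    (hf.fderivWithin (m := 1) hK (by norm_num)).differentiableOn (by norm_num) z hz
  have h1 := ((InnerProductSpace.toDual ℝ E).symm.toContinuousLinearEquiv.hasFDerivAt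
    (x := fderivWithin ℝ f K z)).comp_hasFDerivWithinAt z hd.hasFDerivWithinAt
  have h2 : fderivWithin ℝ (gradientWithin f K) K z = _ := h1.fderivWithin (hK z hz)
  rw [h2]
  exact InnerProductSpace.toDual_symm_apply

/-- The Hessian operator of `f` relative to `K`. -/
noncomputable def hessWithin (f : E → ℝ) (K : Set E) (z : E) : E →L[ℝ] E :=
  fderivWithin ℝ (gradientWithin f K) K z

/-- The third derivative of `f` relative to `K`, as the derivative of the Hessian operator. -/
noncomputable def thirdWithin (f : E → ℝ) (K : Set E) (z : E) : E →L[ℝ] E →L[ℝ] E :=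
  fderivWithin ℝ (hessWithin f K) K z

lemma hasFDerivWithinAt_gradientWithin (hK : UniqueDiffOn ℝ K) (hf : ContDiffOn ℝ 2 f K)
    (hz : z ∈ K) : HasFDerivWithinAt (gradientWithin f K) (hessWithin f K z) K z :=
  ((contDiffOn_gradientWithin (m := 1) hK hf (by norm_num)).differentiableOn (by norm_num)
    z hz).hasFDerivWithinAt

lemma contDiffOn_hessWithin (hK : UniqueDiffOn ℝ K) (hf : ContDiffOn ℝ 3 f K) :
    ContDiffOn ℝ 1 (hessWithin f K) K :=
  (contDiffOn_gradientWithin (m := 2) hK hf (by norm_num)).fderivWithin hK (by norm_num)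

lemma hasFDerivWithinAt_hessWithin (hK : UniqueDiffOn ℝ K) (hf : ContDiffOn ℝ 3 f K)
    (hz : z ∈ K) : HasFDerivWithinAt (hessWithin f K) (thirdWithin f K z) K z :=
  ((contDiffOn_hessWithin hK hf).differentiableOn (by norm_num) z hz).hasFDerivWithinAt

lemma inner_hessWithin_symm (hK : UniqueDiffOn ℝ K) (hf : ContDiffOn ℝ 2 f K)
    (hz : z ∈ K) (hc : z ∈ closure (interior K)) (X Y : E) :
    inner ℝ (hessWithin f K z X) Y = inner ℝ X (hessWithin f K z Y) := by
  rw [real_inner_comm _ X, hessWithin, inner_fderivWithin_gradientWithin hK hf hz,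
    inner_fderivWithin_gradientWithin hK hf hz]
  exact (hf z hz).isSymmSndFDerivWithinAt (by simp) hK hc hz X Y

lemma thirdWithin_symm (hK : UniqueDiffOn ℝ K) (hf : ContDiffOn ℝ 3 f K)
    (hz : z ∈ K) (hc : z ∈ closure (interior K)) (X Y : E) :
    thirdWithin f K z X Y = thirdWithin f K z Y X :=
  (contDiffOn_gradientWithin (m := 2) hK hf (by norm_num) z hz).isSymmSndFDerivWithinAt
    (by simp) hK hc hz X Y

/-- Differentiates the symmetry of the Hessian. Together with `thirdWithin_symm` it makes the third
derivative totally symmetric. -/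
lemma inner_thirdWithin_symm (hK : UniqueDiffOn ℝ K) (hf : ContDiffOn ℝ 3 f K)
    (hc : K ⊆ closure (interior K)) (hz : z ∈ K) (X Y Z : E) :
    inner ℝ (thirdWithin f K z X Y) Z = inner ℝ (thirdWithin f K z X Z) Y := by
  have h := hasFDerivWithinAt_hessWithin hK hf hz
  have h1 := hasFDerivWithinAt_inner_const (hasFDerivWithinAt_apply_const h Y) Z
  have h2 := hasFDerivWithinAt_inner_const (hasFDerivWithinAt_apply_const h Z) Y
  have hs : ∀ x ∈ K, inner ℝ (hessWithin f K x Y) Z = inner ℝ (hessWithin f K x Z) Y := by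
    intro x hx
    rw [inner_hessWithin_symm hK (hf.of_le (by norm_num)) hx (hc hx), real_inner_comm]
  have h3 := (hK z hz).eq h1 (h2.congr hs (hs z hz))
  simpa [real_inner_comm] using congrArg (fun L => L X) h3

/-- Differentiating `⟨∇f(x), x⟩ = 0` and using the symmetry of the Hessian: the gradient is
homogeneous of degree -1. -/
lemma hessWithin_radial (hrad : ∀ x ∈ K, inner ℝ (gradientWithin f K x) x = 0)
    (hK : UniqueDiffOn ℝ K) (hf : ContDiffOn ℝ 2 f K)
    (hc : K ⊆ closure (interior K)) (hz : z ∈ K) :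
    hessWithin f K z z = -gradientWithin f K z := by
  have h1 := (hasFDerivWithinAt_gradientWithin hK hf hz).inner ℝ (hasFDerivWithinAt_id z K)
  have h2 := (hK z hz).eq h1
    ((hasFDerivWithinAt_const (0 : ℝ) z K).congr (fun x hx => hrad x hx) (hrad z hz))
  refine ext_inner_right ℝ fun Y => ?_
  have h3 : inner ℝ (gradientWithin f K z) Y + inner ℝ (hessWithin f K z Y) z = 0 := by
    simpa using congrArg (fun L => L Y) h2
  rw [inner_hessWithin_symm hK hf hz (hc hz), real_inner_comm, inner_neg_left]
  linarith

/-- One more derivative, this time of the identity in `hessWithin_radial`; the factor 2 collects one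
Hessian from each side. -/
lemma thirdWithin_radial (hrad : ∀ x ∈ K, inner ℝ (gradientWithin f K x) x = 0)
    (hK : UniqueDiffOn ℝ K) (hf : ContDiffOn ℝ 3 f K)
    (hc : K ⊆ closure (interior K)) (hz : z ∈ K) (X : E) :
    thirdWithin f K z X z = -(2 : ℝ) • hessWithin f K z X := by
  have hf2 : ContDiffOn ℝ 2 f K := hf.of_le (by norm_num)
  have h1 := (hasFDerivWithinAt_hessWithin hK hf hz).clm_apply (hasFDerivWithinAt_id z K)
  have hs : ∀ x ∈ K, hessWithin f K x (id x) = -gradientWithin f K x := fun x hx =>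
    hessWithin_radial hrad hK hf2 hc hx
  have h2 := (hK z hz).eq h1
    ((hasFDerivWithinAt_gradientWithin hK hf2 hz).neg.congr hs (hs z hz))
  have h3 : hessWithin f K z X + thirdWithin f K z X z = -hessWithin f K z X := by
    simpa using congrArg (fun L => L X) h2
  rw [eq_sub_of_add_eq' h3]
  module

/-- Derivatives of a function of time and space, of class `C²` up to the boundary: the time
derivative is differentiable in space, the spatial gradient is differentiable in time, and the two
mixed derivatives agree. -/
lemma mixed_derivatives {I : Set ℝ} (hI : IsOpen I) (hK : UniqueDiffOn ℝ K)
    (hc : K ⊆ closure (interior K)) {F : ℝ → E → ℝ}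
    (hF : ContDiffOn ℝ 2 (fun q : ℝ × E => F q.1 q.2) (I ×ˢ K)) {t : ℝ} (ht : t ∈ I)
    (hz : z ∈ K) :
    ∃ (L : E →L[ℝ] ℝ) (G : E),
      HasFDerivWithinAt (fun x => deriv (fun s => F s x) t) L K z ∧
      HasDerivAt (fun s => gradientWithin (F s) K z) G t ∧ ∀ X, inner ℝ G X = L X := by
  set Ω := I ×ˢ K with hΩ
  set D := fderivWithin ℝ (fun q : ℝ × E => F q.1 q.2) Ω with hD
  have hu : UniqueDiffOn ℝ Ω := hI.uniqueDiffOn.prod hK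
  have hD1 : ContDiffOn ℝ 1 D Ω := hF.fderivWithin hu (by norm_num)
  have hd : ∀ q ∈ Ω, HasFDerivWithinAt (fun q : ℝ × E => F q.1 q.2) (D q) Ω q := fun q hq =>
    (hF.differentiableOn (by norm_num) q hq).hasFDerivWithinAt
  have hdt : ∀ x ∈ K, deriv (fun s => F s x) t = D (t, x) (1, 0) := by
    intro x hx
    have h1 : HasDerivAt (fun s : ℝ => (s, x)) ((1 : ℝ), (0 : E)) t :=
      (hasDerivAt_id t).prodMk (hasDerivAt_const t x)
    have h2 := (hd (t, x) ⟨ht, hx⟩).comp_hasDerivAt t h1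
      (by filter_upwards [hI.mem_nhds ht] with s hs using ⟨hs, hx⟩)
    exact h2.deriv
  have hdx : ∀ s ∈ I, fderivWithin ℝ (F s) K z = (D (s, z)).comp (.inr ℝ ℝ E) := by
    intro s hs
    have h1 : HasFDerivWithinAt (fun x : E => (s, x)) (.inr ℝ ℝ E) K z :=
      (hasFDerivAt_prodMk_right s z).hasFDerivWithinAt
    exact ((hd (s, z) ⟨hs, hz⟩).comp z h1 (fun x hx => ⟨hs, hx⟩)).fderivWithin (hK z hz)
  have hDD := (hD1.differentiableOn (by norm_num) (t, z) ⟨ht, hz⟩).hasFDerivWithinAt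
  set D2 := fderivWithin ℝ D Ω (t, z) with hD2
  have hsymm : ∀ v w, D2 v w = D2 w v := by
    refine (hF (t, z) ⟨ht, hz⟩).isSymmSndFDerivWithinAt (by simp) hu ?_ ⟨ht, hz⟩
    rw [hΩ, interior_prod_eq, closure_prod_eq, hI.interior_eq]
    exact ⟨subset_closure ht, hc hz⟩
  have h1 : HasFDerivWithinAt (fun x : E => (t, x)) (.inr ℝ ℝ E) K z :=
    (hasFDerivAt_prodMk_right t z).hasFDerivWithinAt
  have h2 := (hasFDerivWithinAt_apply_const hDD ((1 : ℝ), (0 : E))).comp z h1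
    (fun x hx => ⟨ht, hx⟩)
  have h3 : HasDerivAt (fun s : ℝ => (s, z)) ((1 : ℝ), (0 : E)) t :=
    (hasDerivAt_id t).prodMk (hasDerivAt_const t z)
  have h4 := HasFDerivWithinAt.comp_hasDerivAt (E := ℝ × E →L[ℝ] ℝ) t hDD h3
    (by filter_upwards [hI.mem_nhds ht] with s hs using ⟨hs, hz⟩)
  have h5 := (((InnerProductSpace.toDual ℝ E).symm.toContinuousLinearEquiv.hasFDerivAt).comp_hasDerivAt
    t (h4.clm_comp (hasDerivAt_const t (ContinuousLinearMap.inr ℝ ℝ E))))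
  refine ⟨_, _, h2.congr (fun x hx => hdt x hx) (hdt z hz), h5.congr_of_eventuallyEq ?_, ?_⟩
  · filter_upwards [hI.mem_nhds ht] with s hs
    simp [gradientWithin, hdx s hs]
  · intro X
    refine InnerProductSpace.toDual_symm_apply.trans ?_
    simp [hsymm (1, 0)]

end Calculus

/-! ### Maximum principles in one variable and in space-time. -/

/-- If `f` is maximal at the left end point and its derivative vanishes there, the second
derivative at the end point is nonpositive. -/
lemma second_deriv_nonpos_of_max_left {f f' : ℝ → ℝ} {f'' δ : ℝ} (hδ : 0 < δ)
    (hf : ∀ s ∈ Icc 0 δ, HasDerivWithinAt f (f' s) (Icc 0 δ) s) (h0 : f' 0 = 0)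
    (h2 : HasDerivWithinAt f' f'' (Icc 0 δ) 0) (hmax : ∀ s ∈ Icc 0 δ, f s ≤ f 0) : f'' ≤ 0 := by
  by_contra! hpos
  have h3 : HasDerivWithinAt f' f'' (Ioi 0) 0 :=
    h2.mono_of_mem_nhdsWithin (Icc_mem_nhdsGT hδ)
  rw [hasDerivWithinAt_iff_tendsto_slope' (by simp)] at h3
  have h4 := (h3.eventually (lt_mem_nhds hpos)).and (Ioo_mem_nhdsGT hδ)
  obtain ⟨η, hη, h5⟩ := mem_nhdsGT_iff_exists_Ioc_subset.1 h4
  have hη0 : 0 < η := hη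
  have hηδ : η < δ := (h5 ⟨hη0, le_rfl⟩).2.2
  -- Since `f' 0 = 0`, positive slopes of `f'` from 0 mean that `f'` itself is positive on `(0, η]`,
  -- so `f` would increase away from its maximum.
  have hmono : StrictMonoOn f (Icc 0 η) := by
    refine strictMonoOn_of_deriv_pos (convex_Icc 0 η) (fun s hs => ?_) (fun s hs => ?_)
    · exact ((hf s ⟨hs.1, hs.2.trans hηδ.le⟩).continuousWithinAt).mono
        (Icc_subset_Icc_right hηδ.le)
    · rw [interior_Icc] at hs
      have h6 : HasDerivAt f (f' s) s :=
        (hf s ⟨hs.1.le, (hs.2.trans hηδ).le⟩).hasDerivAt (Icc_mem_nhds hs.1 (hs.2.trans hηδ))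
      rw [h6.deriv]
      have h7 : 0 < slope f' 0 s := (h5 ⟨hs.1, hs.2.le⟩).1
      rw [slope_def_field, h0, sub_zero, sub_zero] at h7
      exact (div_pos_iff_of_pos_right hs.1).1 h7
  exact absurd (hmax η ⟨hη0.le, hηδ.le⟩)
    (not_le.2 (hmono ⟨le_rfl, hη0.le⟩ ⟨hη0.le, le_rfl⟩ hη0))

lemma deriv_nonneg_of_max_right {h : ℝ → ℝ} {d a t : ℝ} (hat : a < t) (hd : HasDerivAt h d t)
    (hmax : ∀ s ∈ Icc a t, h s ≤ h t) : 0 ≤ d := by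
  have h1 := (hasDerivWithinAt_iff_tendsto_slope' (by simp)).1 (hd.hasDerivWithinAt (s := Iio t))
  refine ge_of_tendsto h1 ?_
  filter_upwards [Ioo_mem_nhdsLT hat] with s hs
  rw [slope_def_field]
  exact div_nonneg_of_nonpos (sub_nonpos.2 (hmax s ⟨hs.1.le, hs.2.le⟩)) (sub_nonpos.2 hs.2.le)

/-- A maximum principle: if at each spatial maximum point the time derivative of `q` is at most
`-μ q`, then `q` decays like `exp (-μ t)`. -/
lemma max_principle {X : Type*} [TopologicalSpace X] {S : Set X} (hS : IsCompact S) {T : EReal}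
    {q : ℝ → X → ℝ} (hq : ContinuousOn (fun z : ℝ × X => q z.1 z.2) (timeInterval T ×ˢ S))
    {μ M : ℝ} (h0 : ∀ x ∈ S, q 0 x ≤ M)
    (hd : ∀ t ∈ openTimeInterval T, ∀ y ∈ S, (∀ x ∈ S, q t x ≤ q t y) →
      ∃ d, HasDerivAt (fun s => q s y) d t ∧ d ≤ -μ * q t y) :
    ∀ t ∈ timeInterval T, ∀ y ∈ S, q t y ≤ M * Real.exp (-(μ * t)) := by
  intro t ht y hy
  -- The factor `exp (μ t)` reduces to the case of a nonpositive derivative, and the penalty `ε t`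
  -- makes it strictly negative, which rules out a maximum at a positive time.
  have key : ∀ ε : ℝ, 0 < ε → Real.exp (μ * t) * q t y - ε * t ≤ M := by
    intro ε hε
    have hsub : Icc 0 t ⊆ timeInterval T := fun s hs =>
      ⟨hs.1, lt_of_le_of_lt (EReal.coe_le_coe_iff.2 hs.2) ht.2⟩
    have hc : ContinuousOn (fun z : ℝ × X => Real.exp (μ * z.1) * q z.1 z.2 - ε * z.1)
        (Icc 0 t ×ˢ S) := by
      have h1 := hq.mono (prod_mono hsub (le_refl S))
      fun_prop
    obtain ⟨⟨s, x⟩, ⟨hs, hx⟩, hmax⟩ := (isCompact_Icc.prod hS).exists_isMaxOn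
      ⟨(t, y), ⟨ht.1, le_rfl⟩, hy⟩ hc
    have hmax' : ∀ s' ∈ Icc 0 t, ∀ x' ∈ S, Real.exp (μ * s') * q s' x' - ε * s' ≤
        Real.exp (μ * s) * q s x - ε * s := fun s' hs' x' hx' =>
      hmax (show ((s', x') : ℝ × X) ∈ Icc 0 t ×ˢ S from ⟨hs', hx'⟩)
    refine (hmax' t ⟨ht.1, le_rfl⟩ y hy).trans ?_
    rcases hs.1.eq_or_lt with h | hspos
    · have h : s = 0 := h.symm
      subst h
      simpa using h0 x hx
    · exfalso
      obtain ⟨d, hd1, hd2⟩ := hd s ⟨hspos, (hsub hs).2⟩ x hx fun x' hx' => by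
        have := hmax' s hs x' hx'
        have h2 : Real.exp (μ * s) * q s x' ≤ Real.exp (μ * s) * q s x := by linarith
        exact le_of_mul_le_mul_left h2 (Real.exp_pos _)
      have h3 : HasDerivAt (fun s => Real.exp (μ * s) * q s x - ε * s)
          (Real.exp (μ * s) * (μ * 1) * q s x + Real.exp (μ * s) * d - ε * 1) s :=
        ((((hasDerivAt_id s).const_mul μ).exp).mul hd1).sub ((hasDerivAt_id s).const_mul ε)
      have h4 := deriv_nonneg_of_max_right hspos h3
        (fun s' hs' => hmax' s' ⟨hs'.1, hs'.2.trans hs.2⟩ x hx)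
      have h5 : Real.exp (μ * s) * (μ * q s x + d) ≤ 0 :=
        mul_nonpos_of_nonneg_of_nonpos (Real.exp_pos _).le (by linarith)
      linarith
  have h1 : Real.exp (μ * t) * q t y ≤ M := by
    have hlim : Tendsto (fun ε : ℝ => Real.exp (μ * t) * q t y - ε * t) (𝓝[>] 0)
        (𝓝 (Real.exp (μ * t) * q t y - 0 * t)) :=
      (Continuous.tendsto (by fun_prop) 0).mono_left nhdsWithin_le_nhds
    rw [zero_mul, sub_zero] at hlim
    exact le_of_tendsto hlim (by filter_upwards [self_mem_nhdsWithin] with ε hε using key ε hε)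
  rw [Real.exp_neg, ← div_eq_mul_inv, le_div_iff₀ (Real.exp_pos _)]
  linarith

/-! ### Pointwise algebra at a maximum point. -/

/-- The algebraic inequality behind the gradient estimate. -/
lemma reaction_le {N c sh u ε p τ K D : ℝ} (hN : 2 ≤ N) (hc : 1 ≤ c) (hsh : sh ^ 2 = c ^ 2 - 1)
    (hu : 0 ≤ u) (hu1 : u ≤ 1) (hp : 0 ≤ p) (hε : ε ^ 2 ≤ (1 - u ^ 2) * p)
    (hτ : τ ^ 2 ≤ (N - 1) * K) (hD : D ≤ -(N - 1) * p - K) :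
    (sh * p + ε) * τ + (c + u) * D - N * (c * p ^ 2 - p * u)
      ≤ -(((N - 1) + u * (N - 3)) / 2 * p) := by
  have ha : 0 < c + u := by linarith
  have hN1 : 0 < N - 1 := by linarith
  set x := sh * p + ε with hx
  have hx2 : x ^ 2 ≤ 2 * ((c ^ 2 - 1) * p ^ 2) + 2 * ((1 - u ^ 2) * p) := by
    have : x ^ 2 ≤ 2 * (sh ^ 2 * p ^ 2) + 2 * ε ^ 2 := by nlinarith [sq_nonneg (sh * p - ε)]
    rw [hsh] at this
    linarith
  -- Relative to the previous bound the slack is twice `(1 + c u) p² + (c - 1)(1 - u) p`. The factor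
  -- `c + u` will cancel the one in Young's inequality.
  have hx3 : x ^ 2 ≤ 2 * (c + u) * (c * p ^ 2 + (1 - u) * p) := by
    have h1 : 0 ≤ (1 + c * u) * p ^ 2 := by positivity
    have h2 : 0 ≤ (c - 1) * ((1 - u) * p) :=
      mul_nonneg (by linarith) (mul_nonneg (by linarith) hp)
    nlinarith
  have hK : (c + u) * τ ^ 2 ≤ (N - 1) * ((c + u) * K) := by nlinarith
  -- The weights in Young's inequality are chosen so that the `τ²` term is exactly `(c + u) τ² / (N
  -- - 1)`, which `K` absorbs.
  have hyoung : x * τ - (c + u) * K ≤ (N - 1) / 2 * (c * p ^ 2 + (1 - u) * p) := by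
    have h1 : 4 * (c + u) * (N - 1) * (x * τ) ≤ (N - 1) ^ 2 * x ^ 2 + 4 * (c + u) ^ 2 * τ ^ 2 := by
      nlinarith [sq_nonneg ((N - 1) * x - 2 * (c + u) * τ)]
    have h2 : (N - 1) ^ 2 * x ^ 2
        ≤ (N - 1) ^ 2 * (2 * (c + u) * (c * p ^ 2 + (1 - u) * p)) :=
      mul_le_mul_of_nonneg_left hx3 (by positivity)
    have h3 : 4 * (c + u) * ((c + u) * τ ^ 2) ≤ 4 * (c + u) * ((N - 1) * ((c + u) * K)) :=
      mul_le_mul_of_nonneg_left hK (by positivity)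
    have h4 : 0 < 4 * (c + u) * (N - 1) := by positivity
    refine le_of_mul_le_mul_left ?_ h4
    nlinarith
  have hD' : (c + u) * D ≤ (c + u) * (-(N - 1) * p - K) := mul_le_mul_of_nonneg_left hD ha.le
  have h5 : 0 ≤ (N + 1) / 2 * (c * p ^ 2) := by positivity
  have h6 : 0 ≤ (N - 1) * (c - 1) * p := mul_nonneg (mul_nonneg hN1.le (by linarith)) hp
  nlinarith

/-- Trace estimate for the third derivative at a maximum point of the length of the gradient. -/
lemma trace_estimate {E : Type*} [NormedAddCommGroup E] [InnerProductSpace ℝ E]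
    [FiniteDimensional ℝ E] {m : ℕ} (hE : Module.finrank ℝ E = m + 2) {y g : E} {p : ℝ}
    {H A : E →L[ℝ] E} (hy : ‖y‖ = 1) (hgy : inner ℝ g y = 0) (hg : g ≠ 0) (hp : ‖g‖ ^ 2 = p)
    (hHy : H y = -g) (hHg : H g = -p • y) (hAy : A y = (2 * p) • y)
    (hA : ∀ X, ‖X‖ = 1 → inner ℝ X y = 0 → inner ℝ (A X) X ≤ -‖H X‖ ^ 2 - p) :
    ∃ K, (LinearMap.trace ℝ E H) ^ 2 ≤ m * K ∧
      LinearMap.trace ℝ E A - (inner ℝ (A g) g + 2 * p ^ 2) / (1 + p) ≤ -m * p - K := by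
  have hgn : 0 < ‖g‖ := norm_pos_iff.2 hg
  have hp0 : 0 < p := hp ▸ by positivity
  set b1 : E := ‖g‖⁻¹ • g with hb1
  have hb1n : ‖b1‖ = 1 := by simp [hb1, norm_smul, hgn.ne']
  have hb1y : inner ℝ b1 y = 0 := by simp [hb1, inner_smul_left, hgy]
  have hyb1 : inner ℝ y b1 = 0 := by rw [real_inner_comm, hb1y]
  let w : Fin (m + 2) → E := Fin.cons y fun _ => b1
  obtain ⟨b, hb⟩ := Orthonormal.exists_orthonormalBasis_extension_of_card_eq (ι := Fin (m + 2))
    -- An orthonormal basis starting with `y` and `g / |g|`; only its first two values are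
    -- prescribed, so `w` is constant afterwards.
    (by simpa using hE) (v := w) (s := {0, 1}) (by
      rw [orthonormal_iff_ite]
      rintro ⟨i, rfl | rfl⟩ ⟨j, rfl | rfl⟩ <;>
        simp [w, Set.domRestrict, hy, hb1n, hb1y, hyb1]
      all_goals exact fun h => by simpa using congrArg Subtype.val h)
  have hb0 : b 0 = y := by simpa [w] using hb 0 (by simp)
  have hb1' : b 1 = b1 := by simpa [w] using hb 1 (by simp)
  have horth : ∀ i : Fin m, inner ℝ (b i.succ.succ) y = 0 := fun i => by
    rw [← hb0]; exact b.orthonormal.2 (Fin.succ_ne_zero _)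
  have htr : ∀ L : E →L[ℝ] E, LinearMap.trace ℝ E L = inner ℝ (L y) y + inner ℝ (L b1) b1
      + ∑ i : Fin m, inner ℝ (L (b i.succ.succ)) (b i.succ.succ) := fun L => by
    rw [LinearMap.trace_eq_sum_inner _ b, Fin.sum_univ_succ, Fin.sum_univ_succ]
    simp [hb0, hb1', real_inner_comm, add_assoc]
  -- `H` has no diagonal entry in the directions `y` and `g`, so its trace has only `m` terms and
  -- Cauchy–Schwarz costs the factor `m`.
  refine ⟨∑ i : Fin m, ‖H (b i.succ.succ)‖ ^ 2, ?_, ?_⟩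
  · have h1 : LinearMap.trace ℝ E H
        = ∑ i : Fin m, inner ℝ (H (b i.succ.succ)) (b i.succ.succ) := by
      rw [htr, hHy, hb1, map_smul, hHg]
      simp [inner_smul_left, inner_smul_right, hgy, (real_inner_comm _ _).trans hgy]
    rw [h1]
    calc _ ≤ (m : ℝ) * ∑ i : Fin m, (inner ℝ (H (b i.succ.succ)) (b i.succ.succ)) ^ 2 := by
          simpa using sq_sum_le_card_mul_sum_sq (s := (Finset.univ : Finset (Fin m)))
            (f := fun i => (inner ℝ (H (b i.succ.succ)) (b i.succ.succ) : ℝ))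
      _ ≤ _ := by
          refine mul_le_mul_of_nonneg_left (Finset.sum_le_sum fun i _ => ?_) m.cast_nonneg
          rw [sq_le_sq, abs_norm]
          simpa using abs_real_inner_le_norm (H (b i.succ.succ)) (b i.succ.succ)
  · have hyy : inner ℝ (A y) y = 2 * p := by
      rw [hAy, inner_smul_left, real_inner_self_eq_norm_sq, hy]; simp
    have hA1 : inner ℝ (A b1) b1 ≤ -2 * p := by
      refine (hA b1 hb1n hb1y).trans ?_
      have : ‖H b1‖ ^ 2 = p := by
        rw [hb1, map_smul, hHg]
        simp only [norm_smul, norm_neg, hy, mul_one, norm_inv, Real.norm_eq_abs]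
        rw [abs_of_pos hp0, abs_of_pos hgn, mul_pow, inv_pow, hp]
        field_simp
      linarith
    have hAg : inner ℝ (A g) g = p * inner ℝ (A b1) b1 := by
      rw [hb1, map_smul, inner_smul_left, inner_smul_right, ← hp]
      simp only [conj_trivial]
      field_simp
    have hsum : ∑ i : Fin m, inner ℝ (A (b i.succ.succ)) (b i.succ.succ)
        ≤ -m * p - ∑ i : Fin m, ‖H (b i.succ.succ)‖ ^ 2 := by
      calc _ ≤ ∑ i : Fin m, (-‖H (b i.succ.succ)‖ ^ 2 - p) :=
            Finset.sum_le_sum fun i _ => hA _ (b.orthonormal.1 _) (horth i)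
        _ = _ := by simp [Finset.sum_sub_distrib]; ring
    rw [htr, hyy, hAg]
    -- The left side is `(⟨A b1, b1⟩ - 2p²)/(1 + p)`; the bound `-2p` exactly compensates the normal
    -- entry `⟨A y, y⟩ = 2p`.
    have h2 : inner ℝ (A b1) b1 - (p * inner ℝ (A b1) b1 + 2 * p ^ 2) / (1 + p) ≤ -2 * p := by
      rw [sub_le_iff_le_add, ← sub_le_iff_le_add', le_div_iff₀ (by linarith)]
      nlinarith
    linarith

/-! ### Geometry of the half-space cone and great circles in the hemisphere. -/

section Cone

variable {n : ℕ}

lemma hemisphere_subset_cone : hemisphere n ⊆ cone n := fun y hy =>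
  ⟨fun h => by simpa [h] using hy.1, hy.2⟩

lemma isOpen_lastPos : IsOpen {z : Ambient n | 0 < z (Fin.last n)} :=
  isOpen_lt continuous_const (by fun_prop)

lemma lastPos_subset_cone : {z : Ambient n | 0 < z (Fin.last n)} ⊆ cone n := fun z hz =>
  ⟨fun h => by simp [h] at hz, le_of_lt hz⟩

@[simp] lemma northPole_last : northPole n (Fin.last n) = 1 := by simp [northPole]

@[simp] lemma norm_northPole : ‖northPole n‖ = 1 := by simp [northPole]

lemma inner_northPole (z : Ambient n) : inner ℝ (northPole n) z = z (Fin.last n) := by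
  simp [northPole, EuclideanSpace.inner_single_left]

lemma last_le_one {y : Ambient n} (hy : y ∈ hemisphere n) : y (Fin.last n) ≤ 1 := by
  have := real_inner_le_norm (northPole n) y
  rwa [inner_northPole, norm_northPole, hy.1, one_mul] at this

lemma cone_subset_closure_interior : cone n ⊆ closure (interior (cone n)) := by
  intro z hz
  have h1 : Tendsto (fun s : ℝ => z + s • northPole n) (𝓝[>] 0) (𝓝 (z + (0 : ℝ) • northPole n)) :=
    (Continuous.tendsto (by fun_prop) 0).mono_left nhdsWithin_le_nhds
  rw [zero_smul, add_zero] at h1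
  refine mem_closure_of_tendsto h1 ?_
  filter_upwards [self_mem_nhdsWithin] with s hs
  refine interior_maximal lastPos_subset_cone isOpen_lastPos ?_
  have hs' : (0 : ℝ) < s := hs
  simpa using add_pos_of_nonneg_of_pos hz.2 hs'

lemma uniqueDiffOn_cone : UniqueDiffOn ℝ (cone n) := by
  have h1 : Convex ℝ {z : Ambient n | 0 ≤ z (Fin.last n)} :=
    convex_halfSpace_ge (EuclideanSpace.proj (𝕜 := ℝ) (Fin.last n)).toLinearMap.isLinear 0
  have h2 : (interior {z : Ambient n | 0 ≤ z (Fin.last n)}).Nonempty :=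
    ⟨northPole n, interior_maximal (s := {z : Ambient n | 0 ≤ z (Fin.last n)})
      (t := {z : Ambient n | 0 < z (Fin.last n)}) (fun z hz => le_of_lt (a := (0 : ℝ)) hz)
      isOpen_lastPos (by simp)⟩
  have h3 : cone n = {z : Ambient n | 0 ≤ z (Fin.last n)} ∩ {0}ᶜ := by
    ext z; exact and_comm
  rw [h3]
  exact (uniqueDiffOn_convex h1 h2).inter isOpen_compl_singleton

lemma isCompact_hemisphere : IsCompact (hemisphere n) := by
  have h : hemisphere n = Metric.sphere 0 1 ∩ {z : Ambient n | 0 ≤ z (Fin.last n)} := by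
    ext z; simp [hemisphere]
  rw [h]
  exact (isCompact_sphere _ _).inter_right (isClosed_le continuous_const (by fun_prop))

/-- The great circle through `y` with direction `X`. -/
noncomputable def arc (y X : Ambient n) (s : ℝ) : Ambient n := Real.cos s • y + Real.sin s • X

@[simp] lemma arc_zero (y X : Ambient n) : arc y X 0 = y := by simp [arc]

lemma hasDerivAt_arc (y X : Ambient n) (s : ℝ) :
    HasDerivAt (arc y X) (-Real.sin s • y + Real.cos s • X) s :=
  ((Real.hasDerivAt_cos s).smul_const y).add ((Real.hasDerivAt_sin s).smul_const X)

lemma hasDerivAt_arc_zero (y X : Ambient n) : HasDerivAt (arc y X) X 0 := by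
  simpa using hasDerivAt_arc y X 0

lemma continuous_arc (y X : Ambient n) : Continuous (arc y X) := by
  unfold arc; fun_prop

lemma norm_arc {y X : Ambient n} (hy : ‖y‖ = 1) (hX : ‖X‖ = 1) (hXy : inner ℝ X y = 0) (s : ℝ) :
    ‖arc y X s‖ = 1 := by
  have h : ‖arc y X s‖ ^ 2 = 1 := by
    rw [arc, norm_add_sq_real, inner_smul_left, inner_smul_right, real_inner_comm, hXy,
      norm_smul, norm_smul, hy, hX]
    simp
  nlinarith [norm_nonneg (arc y X s), sq_nonneg (‖arc y X s‖ - 1)]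

/-- From an interior point every great circle stays inside for a short time; from the equator it is
enough that the direction does not point outwards. The two-sided version needs a direction tangent
to the equator. -/
lemma arc_mem_hemisphere_right {y X : Ambient n} (hy : y ∈ hemisphere n) (hX : ‖X‖ = 1)
    (hXy : inner ℝ X y = 0) (h : 0 < y (Fin.last n) ∨ 0 ≤ X (Fin.last n)) :
    ∃ δ > 0, ∀ s ∈ Icc 0 δ, arc y X s ∈ hemisphere n := by
  rcases h with h | h
  · have h1 : ∀ᶠ s in 𝓝 (0 : ℝ), 0 < arc y X s (Fin.last n) := by
      have : ContinuousAt (fun s => arc y X s (Fin.last n)) 0 := by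
        have := continuous_arc y X
        fun_prop
      exact this.eventually (lt_mem_nhds (by simpa using h))
    obtain ⟨δ, hδ, h2⟩ := Metric.eventually_nhds_iff.1 h1
    refine ⟨δ / 2, by positivity, fun s hs => ⟨norm_arc hy.1 hX hXy s, (h2 ?_).le⟩⟩
    rw [Real.dist_eq, sub_zero, abs_of_nonneg hs.1]
    linarith [hs.2]
  · refine ⟨1, one_pos, fun s hs => ⟨norm_arc hy.1 hX hXy s, ?_⟩⟩
    have h1 : 0 ≤ Real.cos s := Real.cos_nonneg_of_mem_Icc
      ⟨by linarith [hs.1, Real.pi_pos], by linarith [hs.2, Real.pi_gt_three]⟩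
    have h2 : 0 ≤ Real.sin s := Real.sin_nonneg_of_nonneg_of_le_pi hs.1
      (by linarith [hs.2, Real.pi_gt_three])
    simpa [arc] using add_nonneg (mul_nonneg h1 hy.2) (mul_nonneg h2 h)

lemma arc_mem_hemisphere {y X : Ambient n} (hy : y ∈ hemisphere n) (hX : ‖X‖ = 1)
    (hXy : inner ℝ X y = 0) (h : 0 < y (Fin.last n) ∨ X (Fin.last n) = 0) :
    ∀ᶠ s in 𝓝 (0 : ℝ), arc y X s ∈ hemisphere n := by
  obtain ⟨δ, hδ, h1⟩ := arc_mem_hemisphere_right hy hX hXy (h.imp_right ge_of_eq)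
  obtain ⟨δ', hδ', h2⟩ := arc_mem_hemisphere_right (X := -X) hy (by simpa) (by simpa)
    (h.imp_right fun h => by simp [h])
  filter_upwards [Ioo_mem_nhds (neg_neg_of_pos hδ') hδ] with s hs
  rcases le_total 0 s with h3 | h3
  · exact h1 s ⟨h3, hs.2.le⟩
  · simpa [arc] using h2 (-s) ⟨by linarith, by linarith [hs.1]⟩

end Cone

/-! ### Spherical quantities expressed through the ambient derivatives. -/

section Sphere

variable {n : ℕ} {f : Ambient n → ℝ} {y : Ambient n}

/-- The derivative of the gradient of the radially constant extension. -/
noncomputable def ambientHess (f : Ambient n → ℝ) : Ambient n → Ambient n →L[ℝ] Ambient n :=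
  hessWithin (radialExt f) (cone n)

/-- The derivative of `ambientHess`. -/
noncomputable def ambientThird (f : Ambient n → ℝ) :
    Ambient n → Ambient n →L[ℝ] Ambient n →L[ℝ] Ambient n :=
  thirdWithin (radialExt f) (cone n)

lemma radialExt_of_mem (hy : y ∈ hemisphere n) : radialExt f y = f y := by
  simp [radialExt, hy.1]

lemma inner_sphereGrad (X : Ambient n) :
    inner ℝ (sphereGrad f y) X = fderivWithin ℝ (radialExt f) (cone n) y X :=
  inner_gradientWithin X

lemma inner_sphereGrad_self (hf : ContDiffOn ℝ 1 (radialExt f) (cone n)) (hy : y ∈ cone n) :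
    inner ℝ (sphereGrad f y) y = 0 := by
  have hpos : ∀ᶠ s in 𝓝 (0 : ℝ), 0 < 1 + s :=
    (show ContinuousAt (fun s : ℝ => 1 + s) 0 by fun_prop).eventually (lt_mem_nhds (by simp))
  have hcurve : HasDerivAt (fun s : ℝ => (1 + s) • y) y 0 := by
    simpa using ((hasDerivAt_id (0 : ℝ)).const_add 1).smul_const y
  have hd : HasFDerivWithinAt (radialExt f) (fderivWithin ℝ (radialExt f) (cone n) y) (cone n)
      ((fun s : ℝ => (1 + s) • y) 0) := by
    simpa using (hf.differentiableOn (by norm_num) y hy).hasFDerivWithinAt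
  have h1 := hd.comp_hasDerivAt 0 hcurve (by
    filter_upwards [hpos] with s hs
    exact ⟨smul_ne_zero hs.ne' hy.1, by simpa using mul_nonneg hs.le hy.2⟩)
  have h2 : HasDerivAt (radialExt f ∘ fun s : ℝ => (1 + s) • y) 0 0 := by
    refine (hasDerivAt_const (0 : ℝ) (radialExt f y)).congr_of_eventuallyEq ?_
    filter_upwards [hpos] with s hs
    simp only [Function.comp, radialExt, norm_smul, Real.norm_of_nonneg hs.le, mul_inv, smul_smul]
    congr 2
    field_simp
  rw [inner_sphereGrad]
  exact h1.unique h2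

lemma hasFDerivWithinAt_sphereGrad (hf : ContDiffOn ℝ 3 (radialExt f) (cone n)) (hy : y ∈ cone n) :
    HasFDerivWithinAt (sphereGrad f) (ambientHess f y) (cone n) y :=
  hasFDerivWithinAt_gradientWithin uniqueDiffOn_cone (hf.of_le (by norm_num)) hy

lemma hasFDerivWithinAt_ambientHess (hf : ContDiffOn ℝ 3 (radialExt f) (cone n))
    (hy : y ∈ cone n) :
    HasFDerivWithinAt (ambientHess f) (ambientThird f y) (cone n) y :=
  hasFDerivWithinAt_hessWithin uniqueDiffOn_cone hf hy

lemma continuousOn_ambientHess (hf : ContDiffOn ℝ 3 (radialExt f) (cone n)) :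
    ContinuousOn (ambientHess f) (cone n) := fun _ hy =>
  (hasFDerivWithinAt_ambientHess hf hy).continuousWithinAt

lemma continuousOn_sphereGrad (hf : ContDiffOn ℝ 1 (radialExt f) (cone n)) :
    ContinuousOn (sphereGrad f) (cone n) :=
  (contDiffOn_gradientWithin (m := 0) uniqueDiffOn_cone hf (by norm_num)).continuousOn

lemma ambientHess_symm (hf : ContDiffOn ℝ 3 (radialExt f) (cone n)) (hy : y ∈ cone n)
    (X Y : Ambient n) : inner ℝ (ambientHess f y X) Y = inner ℝ X (ambientHess f y Y) :=
  inner_hessWithin_symm uniqueDiffOn_cone (hf.of_le (by norm_num)) hy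
    (cone_subset_closure_interior hy) X Y

lemma ambientHess_self (hf : ContDiffOn ℝ 3 (radialExt f) (cone n)) (hy : y ∈ cone n) :
    ambientHess f y y = -sphereGrad f y :=
  hessWithin_radial (fun _ hx => inner_sphereGrad_self (hf.of_le (by norm_num)) hx)
    uniqueDiffOn_cone (hf.of_le (by norm_num)) cone_subset_closure_interior hy

lemma ambientThird_self (hf : ContDiffOn ℝ 3 (radialExt f) (cone n)) (hy : y ∈ cone n)
    (X : Ambient n) : ambientThird f y X y = -(2 : ℝ) • ambientHess f y X :=
  thirdWithin_radial (fun _ hx => inner_sphereGrad_self (hf.of_le (by norm_num)) hx)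
    uniqueDiffOn_cone hf cone_subset_closure_interior hy X

/-- Plays the role of commuting covariant derivatives in the Bochner formula: the trace of the left
side comes from differentiating the equation along `Z`, while the right side is controlled by the
second order condition. -/
lemma inner_ambientThird (hf : ContDiffOn ℝ 3 (radialExt f) (cone n)) (hy : y ∈ cone n)
    (X Z : Ambient n) :
    inner ℝ (ambientThird f y Z X) X = inner ℝ (ambientThird f y X X) Z := by
  rw [ambientThird, thirdWithin_symm uniqueDiffOn_cone hf hy (cone_subset_closure_interior hy),
    inner_thirdWithin_symm uniqueDiffOn_cone hf cone_subset_closure_interior hy]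

lemma sphereHess_of_inner_eq_zero {X Y : Ambient n} (hX : inner ℝ X y = 0)
    (hY : inner ℝ Y y = 0) : sphereHess f y X Y = inner ℝ (ambientHess f y X) Y := by
  rw [real_inner_comm] at hX hY
  simp [sphereHess, tangentProj, hX, hY]
  rfl

/-- Projecting to the tangent space changes each diagonal entry by `2⟨∇f, X⟩⟨X, y⟩`, and these sum
to `2⟨∇f, y⟩ = 0`. -/
lemma sphereLaplacian_eq_trace (hf : ContDiffOn ℝ 3 (radialExt f) (cone n))
    (hy : y ∈ hemisphere n) :
    sphereLaplacian f y = LinearMap.trace ℝ (Ambient n) (ambientHess f y) := by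
  have hyc := hemisphere_subset_cone hy
  have hself := ambientHess_self hf hyc
  have hgy := inner_sphereGrad_self (hf.of_le (by norm_num)) hyc
  have h1 : ∀ X : Ambient n, sphereHess f y X X
      = inner ℝ X (ambientHess f y X) + 2 * (inner ℝ (sphereGrad f y) X * inner ℝ X y) := by
    intro X
    have h2 : inner ℝ (ambientHess f y X) y = -inner ℝ (sphereGrad f y) X := by
      rw [ambientHess_symm hf hyc, hself, inner_neg_right, real_inner_comm]
    change inner ℝ (ambientHess f y (tangentProj y X)) (tangentProj y X) = _
    simp only [tangentProj, map_sub, map_smul, inner_sub_left, inner_sub_right, inner_smul_left,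
      inner_smul_right, hself, inner_neg_left, hgy, h2, conj_trivial]
    rw [real_inner_comm X y, real_inner_comm X (ambientHess f y X)]
    ring
  have h3 := (EuclideanSpace.basisFun (Fin (n + 1)) ℝ).sum_inner_mul_inner (sphereGrad f y) y
  rw [LinearMap.trace_eq_sum_inner _ (EuclideanSpace.basisFun (Fin (n + 1)) ℝ), sphereLaplacian]
  simp only [h1, Finset.sum_add_distrib, ← Finset.mul_sum]
  simp only [EuclideanSpace.basisFun_apply] at h3 ⊢
  rw [h3, hgy]
  simp

/-- The right-hand side of the flow, multiplied by `v`. -/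
noncomputable def scaledRHS (f : Ambient n → ℝ) (y : Ambient n) : ℝ :=
  (Real.cosh (radialExt f y) + y (Fin.last n)) *
      (LinearMap.trace ℝ (Ambient n) (ambientHess f y)
        - inner ℝ (ambientHess f y (sphereGrad f y)) (sphereGrad f y)
          / (1 + ‖sphereGrad f y‖ ^ 2))
    - n * (sphereGrad f y (Fin.last n)
        + Real.sinh (radialExt f y) * ‖sphereGrad f y‖ ^ 2)

/-- With `ρ = e^f`, `1/(ρ e^w) = cosh f + cos φ` and `(ρ² - 1)/(2ρ) = sinh f`; tangency of the
gradient turns `sin φ f_φ` into minus its last coordinate. -/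
lemma flowRHS_mul_sqrt (hf : ContDiffOn ℝ 3 (radialExt f) (cone n)) (hy : y ∈ hemisphere n) :
    flowRHS f y * Real.sqrt (1 + ‖sphereGrad f y‖ ^ 2) = scaledRHS f y := by
  have hgy := inner_sphereGrad_self (hf.of_le (by norm_num)) (hemisphere_subset_cone hy)
  have hv : 0 < Real.sqrt (1 + ‖sphereGrad f y‖ ^ 2) := Real.sqrt_pos.2 (by positivity)
  have hv2 : Real.sqrt (1 + ‖sphereGrad f y‖ ^ 2) ^ 2 = 1 + ‖sphereGrad f y‖ ^ 2 :=
    Real.sq_sqrt (by positivity)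
  have hX : inner ℝ (sinPhiDPhi y) (sphereGrad f y) = -sphereGrad f y (Fin.last n) := by
    rw [sinPhiDPhi, inner_sub_left, inner_smul_left, real_inner_comm, hgy, inner_northPole]
    simp
  have hρ := Real.exp_pos (f y)
  have hw : 0 < 1 + Real.exp (f y) ^ 2 + 2 * Real.exp (f y) * y (Fin.last n) := by
    have := mul_nonneg hρ.le hy.2
    nlinarith [sq_nonneg (Real.exp (f y))]
  simp only [flowRHS, scaledRHS, expW, radialExt_of_mem hy, hX, hv2, sphereLaplacian_eq_trace hf hy,
    sphereHess_of_inner_eq_zero hgy hgy, Real.cosh_eq, Real.sinh_eq, Real.exp_neg]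
  generalize Real.sqrt (1 + ‖sphereGrad f y‖ ^ 2) = v at *
  have hp : 0 < 1 + ‖sphereGrad f y‖ ^ 2 := by positivity
  field_simp
  ring

end Sphere

/-! ### First and second order conditions and the evolution inequality at a maximum point. -/

section Maximum

variable {n : ℕ} {f : Ambient n → ℝ} {y : Ambient n}

lemma continuousOn_trace {K : Set (Ambient n)} {H : Ambient n → Ambient n →L[ℝ] Ambient n}
    (hH : ContinuousOn H K) :
    ContinuousOn (fun z => LinearMap.trace ℝ (Ambient n) (H z)) K := by
  simp only [LinearMap.trace_eq_sum_inner _ (EuclideanSpace.basisFun (Fin (n + 1)) ℝ)]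
  refine continuousOn_finsetSum _ fun i _ => ?_
  exact continuousOn_const.inner (hH.clm_apply continuousOn_const)

lemma hasDerivAt_trace {H : ℝ → Ambient n →L[ℝ] Ambient n} {H' : Ambient n →L[ℝ] Ambient n}
    {s : ℝ} (hH : HasDerivAt H H' s) :
    HasDerivAt (fun s => LinearMap.trace ℝ (Ambient n) (H s))
      (LinearMap.trace ℝ (Ambient n) H') s := by
  simp only [LinearMap.trace_eq_sum_inner _ (EuclideanSpace.basisFun (Fin (n + 1)) ℝ)]
  refine HasDerivAt.fun_sum fun i _ => ?_
  simpa using (hasDerivAt_const s (EuclideanSpace.basisFun (Fin (n + 1)) ℝ i)).inner ℝ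
    (hH.clm_apply (hasDerivAt_const s (EuclideanSpace.basisFun (Fin (n + 1)) ℝ i)))

lemma continuousOn_scaledRHS (hf : ContDiffOn ℝ 3 (radialExt f) (cone n)) :
    ContinuousOn (scaledRHS f) (cone n) := by
  have h0 := hf.continuousOn
  have h1 := continuousOn_sphereGrad (hf.of_le (by norm_num))
  have h2 := continuousOn_ambientHess hf
  have h3 := continuousOn_trace h2
  have h4 := (h2.clm_apply h1).inner (𝕜 := ℝ) h1
  have h5 : ContinuousOn (fun z => sphereGrad f z (Fin.last n)) (cone n) :=
    (EuclideanSpace.proj (𝕜 := ℝ) (Fin.last n)).continuous.comp_continuousOn h1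
  have h6 : ContinuousOn (fun z : Ambient n => z (Fin.last n)) (cone n) := by fun_prop
  have h7 : ∀ z ∈ cone n, 1 + ‖sphereGrad f z‖ ^ 2 ≠ 0 := fun z _ => by positivity
  exact (((Real.continuous_cosh.comp_continuousOn h0).add h6).mul
    (h3.sub (h4.div (continuousOn_const.add (h1.norm.pow 2)) h7))).sub
    (continuousOn_const.mul (h5.add ((Real.continuous_sinh.comp_continuousOn h0).mul
      (h1.norm.pow 2))))

/-- Two functions which are continuous on the closed hemisphere and agree on the open one agree. -/
lemma eqOn_hemisphere {φ ψ : Ambient n → ℝ} (hφ : ContinuousOn φ (hemisphere n))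
    (hψ : ContinuousOn ψ (hemisphere n))
    (h : ∀ y ∈ hemisphere n, 0 < y (Fin.last n) → φ y = ψ y) : EqOn φ ψ (hemisphere n) := by
  intro y hy
  rcases hy.2.eq_or_lt with h0 | h0
  · have hey : inner ℝ (northPole n) y = 0 := by rw [inner_northPole, h0]
    obtain ⟨δ, hδ, hmem⟩ := arc_mem_hemisphere_right (X := northPole n) hy (by simp) hey
      (Or.inr (by simp))
    have hlim : Tendsto (arc y (northPole n)) (𝓝[>] 0) (𝓝[hemisphere n] y) := by
      refine tendsto_nhdsWithin_iff.2 ⟨?_, ?_⟩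
      · simpa using ((continuous_arc y (northPole n)).tendsto 0).mono_left nhdsWithin_le_nhds
      · filter_upwards [Ioo_mem_nhdsGT hδ] with s hs using hmem s ⟨hs.1.le, hs.2.le⟩
    refine tendsto_nhds_unique_of_eventuallyEq ((hφ y hy).tendsto.comp hlim)
      ((hψ y hy).tendsto.comp hlim) ?_
    filter_upwards [Ioo_mem_nhdsGT hδ, Ioo_mem_nhdsGT Real.pi_pos] with s hs hs'
    refine h _ (hmem s ⟨hs.1.le, hs.2.le⟩) ?_
    simpa [arc, ← h0] using Real.sin_pos_of_mem_Ioo hs'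
  · exact h y hy h0

lemma hasDerivAt_sphereGrad_arc (hf : ContDiffOn ℝ 3 (radialExt f) (cone n))
    (hy : y ∈ hemisphere n) {X : Ambient n} (hX : ‖X‖ = 1) (hXy : inner ℝ X y = 0)
    (h : 0 < y (Fin.last n) ∨ X (Fin.last n) = 0) :
    HasDerivAt (fun s => sphereGrad f (arc y X s)) (ambientHess f y X) 0 := by
  have h1 : HasFDerivWithinAt (sphereGrad f) (ambientHess f y) (cone n) (arc y X 0) := by
    simpa using hasFDerivWithinAt_sphereGrad hf (hemisphere_subset_cone hy)
  exact h1.comp_hasDerivAt 0 (hasDerivAt_arc_zero y X)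
    ((arc_mem_hemisphere hy hX hXy h).mono fun s hs => hemisphere_subset_cone hs)

/-- The first order condition at a maximum point of the length of the gradient. -/
lemma ambientHess_sphereGrad_of_max (hf : ContDiffOn ℝ 3 (radialExt f) (cone n))
    (hN : ∀ x ∈ hemisphere n, x (Fin.last n) = 0 → sphereGrad f x (Fin.last n) = 0)
    (hy : y ∈ hemisphere n)
    (hmax : ∀ x ∈ hemisphere n, ‖sphereGrad f x‖ ^ 2 ≤ ‖sphereGrad f y‖ ^ 2) :
    ambientHess f y (sphereGrad f y) = -‖sphereGrad f y‖ ^ 2 • y := by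
  have hyc := hemisphere_subset_cone hy
  have hgy := inner_sphereGrad_self (hf.of_le (by norm_num)) hyc
  have hself := ambientHess_self hf hyc
  set g := sphereGrad f y with hg
  set H := ambientHess f y with hH
  have hunit : ∀ X : Ambient n, ‖X‖ = 1 → inner ℝ X y = 0 →
      (0 < y (Fin.last n) ∨ X (Fin.last n) = 0) → inner ℝ (H X) g = 0 := by
    intro X hX hXy h
    have h1 := (hasDerivAt_sphereGrad_arc hf hy hX hXy h).norm_sq
    have h2 : IsLocalMax (fun s => ‖sphereGrad f (arc y X s)‖ ^ 2) 0 := by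
      filter_upwards [arc_mem_hemisphere hy hX hXy h] with s hs
      simpa using hmax _ hs
    have h3 := h2.hasDerivAt_eq_zero h1
    rw [arc_zero, real_inner_comm] at h3
    linarith
  have hscale : ∀ X : Ambient n, inner ℝ X y = 0 →
      (0 < y (Fin.last n) ∨ X (Fin.last n) = 0) → inner ℝ (H X) g = 0 := by
    intro X hXy h
    by_cases hX0 : X = 0
    · simp [hX0]
    have hXn := norm_ne_zero_iff.2 hX0
    have h1 := hunit (‖X‖⁻¹ • X) (by simp [norm_smul, hXn]) (by simp [inner_smul_left, hXy])
      (h.imp_right fun h => by simp [h])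
    rw [map_smul, inner_smul_left] at h1
    simpa [hXn] using h1
  -- On the equator only tangential directions allow a two-sided variation. The conormal direction
  -- is handled by `⟨H E, g⟩ = ⟨E, H g⟩`, with `E` the north pole.
  have hall : ∀ X : Ambient n, inner ℝ X y = 0 → inner ℝ (H X) g = 0 := by
    intro X hXy
    rcases hy.2.lt_or_eq with h0 | h0
    · exact hscale X hXy (Or.inl h0)
    have hglast : g (Fin.last n) = 0 := hN y hy h0.symm
    -- By the Neumann condition `g` is tangent to the equator, and the last coordinate of the
    -- gradient vanishes along the great circle in that direction.
    have hlast : (H g) (Fin.last n) = 0 := by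
      by_cases hg0 : g = 0
      · simp [hg0]
      have hgn := norm_ne_zero_iff.2 hg0
      set b := ‖g‖⁻¹ • g with hb
      have hbn : ‖b‖ = 1 := by simp [hb, norm_smul, hgn]
      have hby : inner ℝ b y = 0 := by simp [hb, inner_smul_left, hgy]
      have hbl : b (Fin.last n) = 0 := by simp [hb, hglast]
      have h1 := hasDerivAt_sphereGrad_arc hf hy hbn hby (Or.inr hbl)
      have h2 := ((EuclideanSpace.proj (𝕜 := ℝ) (Fin.last n)).hasFDerivAt).comp_hasDerivAt 0 h1
      have h3 : HasDerivAt (EuclideanSpace.proj (𝕜 := ℝ) (Fin.last n) ∘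
          fun s => sphereGrad f (arc y b s)) 0 0 := by
        refine (hasDerivAt_const (0 : ℝ) (0 : ℝ)).congr_of_eventuallyEq ?_
        filter_upwards [arc_mem_hemisphere hy hbn hby (Or.inr hbl)] with s hs
        exact hN _ hs (by simp [arc, hbl, ← h0])
      have h4 : (H b) (Fin.last n) = 0 := h2.unique h3
      simpa [hb, hgn] using h4
    have hsplit : X = (X - X (Fin.last n) • northPole n) + X (Fin.last n) • northPole n := by
      simp
    have he : inner ℝ (H (northPole n)) g = 0 := by
      rw [hH, ambientHess_symm hf hyc, inner_northPole, ← hH, hlast]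
    rw [hsplit, map_add, map_smul, inner_add_left, inner_smul_left, he, mul_zero, add_zero]
    refine hscale _ ?_ (Or.inr (by simp))
    rw [inner_sub_left, inner_smul_left, inner_northPole, ← h0, hXy]
    simp
  refine ext_inner_left ℝ fun X => ?_
  have h1 : inner ℝ (X - inner ℝ X y • y) y = 0 := by
    rw [inner_sub_left, inner_smul_left, real_inner_self_eq_norm_sq, hy.1]; simp
  have h2 := hall _ h1
  have hyHg : inner ℝ y (H g) = -‖g‖ ^ 2 := by
    rw [hH, ← ambientHess_symm hf hyc, ← hH, hself, inner_neg_left, real_inner_self_eq_norm_sq]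
  rw [hH, ambientHess_symm hf hyc, ← hH, inner_sub_left, inner_smul_left, sub_eq_zero,
    hyHg] at h2
  rw [h2, inner_smul_right]
  simp [mul_comm]

/-- The second order condition at a maximum point of the length of the gradient. -/
lemma inner_ambientThird_le_of_max (hf : ContDiffOn ℝ 3 (radialExt f) (cone n))
    (hN : ∀ x ∈ hemisphere n, x (Fin.last n) = 0 → sphereGrad f x (Fin.last n) = 0)
    (hy : y ∈ hemisphere n)
    (hmax : ∀ x ∈ hemisphere n, ‖sphereGrad f x‖ ^ 2 ≤ ‖sphereGrad f y‖ ^ 2)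
    {X : Ambient n} (hX : ‖X‖ = 1) (hXy : inner ℝ X y = 0) :
    inner ℝ (ambientThird f y X X) (sphereGrad f y)
      ≤ -‖ambientHess f y X‖ ^ 2 - ‖sphereGrad f y‖ ^ 2 := by
  -- The claim is even in `X`, so the direction may be taken to point inwards; a one-sided variation
  -- suffices because the first derivative vanishes.
  wlog h : 0 ≤ X (Fin.last n) generalizing X
  · have := this (X := -X) (by simpa) (by simpa) (by simp; linarith)
    simpa using this
  have hyc := hemisphere_subset_cone hy
  obtain ⟨δ, hδ, hmem⟩ := arc_mem_hemisphere_right hy hX hXy (Or.inr h)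
  have hmaps : MapsTo (arc y X) (Icc 0 δ) (cone n) := fun s hs =>
    hemisphere_subset_cone (hmem s hs)
  have h0 : (0 : ℝ) ∈ Icc 0 δ := ⟨le_rfl, hδ.le⟩
  have hg : ∀ s ∈ Icc 0 δ, HasDerivWithinAt (fun s => sphereGrad f (arc y X s))
      (ambientHess f (arc y X s) (-Real.sin s • y + Real.cos s • X)) (Icc 0 δ) s := fun s hs =>
    (hasFDerivWithinAt_sphereGrad hf (hmaps hs)).comp_hasDerivWithinAt s
      (hasDerivAt_arc y X s).hasDerivWithinAt hmaps
  -- The acceleration `-y` of the great circle contributes `H(-y) = g`, the source of the curvature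
  -- term `-‖g‖²`.
  have hvel : HasDerivAt (fun s : ℝ => -Real.sin s • y + Real.cos s • X) (-y) 0 := by
    have := ((Real.hasDerivAt_sin 0).fun_neg.smul_const y).fun_add
      ((Real.hasDerivAt_cos 0).smul_const X)
    simpa only [Real.cos_zero, Real.sin_zero, neg_zero, zero_smul, add_zero, neg_smul, one_smul]
      using this
  have hH0 : HasDerivWithinAt (fun s => ambientHess f (arc y X s)) (ambientThird f y X)
      (Icc 0 δ) 0 := by
    refine HasFDerivWithinAt.comp_hasDerivWithinAt (E := Ambient n →L[ℝ] Ambient n) 0 ?_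
      (hasDerivAt_arc_zero y X).hasDerivWithinAt hmaps
    rw [arc_zero]
    exact hasFDerivWithinAt_ambientHess hf hyc
  have hfirst := fun s hs => (hg s hs).norm_sq
  have hsecond := ((hg 0 h0).inner ℝ (hH0.clm_apply hvel.hasDerivWithinAt)).const_mul 2
  have hcrit : inner ℝ (ambientHess f y X) (sphereGrad f y) = 0 := by
    rw [ambientHess_symm hf hyc, ambientHess_sphereGrad_of_max hf hN hy hmax, inner_smul_right,
      hXy, mul_zero]
  have := second_deriv_nonpos_of_max_left hδ hfirst (by simpa [real_inner_comm] using hcrit)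
    hsecond (fun s hs => by simpa using hmax _ (hmem s hs))
  simp only [arc_zero, Real.sin_zero, Real.cos_zero, neg_zero, zero_smul, zero_add, one_smul,
    map_neg, ambientHess_self hf hyc, neg_neg, inner_add_right, real_inner_self_eq_norm_sq] at this
  rw [real_inner_comm]
  linarith

/-- The evolution inequality at a maximum point of the length of the gradient: here `τ` is the time
derivative of the solution and `L` its differential. -/
lemma time_deriv_le_of_max (hn : 2 ≤ n) (hf : ContDiffOn ℝ 3 (radialExt f) (cone n))
    (hN : ∀ x ∈ hemisphere n, x (Fin.last n) = 0 → sphereGrad f x (Fin.last n) = 0)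
    (hy : y ∈ hemisphere n)
    (hmax : ∀ x ∈ hemisphere n, ‖sphereGrad f x‖ ^ 2 ≤ ‖sphereGrad f y‖ ^ 2)
    {τ : Ambient n → ℝ} {L : Ambient n →L[ℝ] ℝ} (hτ : HasFDerivWithinAt τ L (cone n) y)
    (heq : ∀ x ∈ hemisphere n, τ x * Real.sqrt (1 + ‖sphereGrad f x‖ ^ 2) = scaledRHS f x) :
    L (sphereGrad f y) * Real.sqrt (1 + ‖sphereGrad f y‖ ^ 2)
      ≤ -((((n : ℝ) - 1) + y (Fin.last n) * (n - 3)) / 2 * ‖sphereGrad f y‖ ^ 2) := by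
  have hyc := hemisphere_subset_cone hy
  have hgy := inner_sphereGrad_self (hf.of_le (by norm_num)) hyc
  have hself := ambientHess_self hf hyc
  have hHg := ambientHess_sphereGrad_of_max hf hN hy hmax
  by_cases hg0 : sphereGrad f y = 0
  · simp [hg0]
  have hgn := norm_ne_zero_iff.2 hg0
  set g := sphereGrad f y with hg
  set H := ambientHess f y with hH
  set r := ‖g‖ with hr
  set b := r⁻¹ • g with hb
  have hgb : g = r • b := by rw [hb, smul_smul, mul_inv_cancel₀ hgn, one_smul]
  have hbn : ‖b‖ = 1 := by
    rw [hb, norm_smul, norm_inv, hr, norm_norm, inv_mul_cancel₀ (hr ▸ hgn)]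
  have hby : inner ℝ b y = 0 := by simp [hb, inner_smul_left, hgy]
  have hHb : H b = -r • y := by
    rw [hb, map_smul, hHg, smul_smul]
    congr 1
    field_simp
  -- The equation can be differentiated along `b` in both directions, even at a boundary maximum.
  have hadm : 0 < y (Fin.last n) ∨ b (Fin.last n) = 0 := by
    rcases hy.2.lt_or_eq with h | h
    · exact Or.inl h
    · right
      have : g (Fin.last n) = 0 := hN y hy h.symm
      simp [hb, this]
  have hmem := arc_mem_hemisphere hy hbn hby hadm
  have hmemc : ∀ᶠ s in 𝓝 (0 : ℝ), arc y b s ∈ cone n :=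
    hmem.mono fun s hs => hemisphere_subset_cone hs
  have harc := hasDerivAt_arc_zero y b
  have dG : HasDerivAt (fun s => sphereGrad f (arc y b s)) (-r • y) 0 :=
    hHb ▸ hasDerivAt_sphereGrad_arc hf hy hbn hby hadm
  have dH : HasDerivAt (fun s => ambientHess f (arc y b s)) (ambientThird f y b) 0 := by
    refine HasFDerivWithinAt.comp_hasDerivAt (E := Ambient n →L[ℝ] Ambient n) 0 ?_ harc hmemc
    rw [arc_zero]
    exact hasFDerivWithinAt_ambientHess hf hyc
  have dF : HasDerivAt (fun s => radialExt f (arc y b s)) r 0 := by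
    have h1 : HasFDerivWithinAt (radialExt f) (fderivWithin ℝ (radialExt f) (cone n) y) (cone n)
        (arc y b 0) := by
      simpa using (hf.differentiableOn (by norm_num) y hyc).hasFDerivWithinAt
    have h2 := h1.comp_hasDerivAt 0 harc hmemc
    rw [← inner_sphereGrad, ← hg, hb, inner_smul_right, real_inner_self_eq_norm_sq, ← hr] at h2
    exact h2.congr_deriv (by rw [sq, inv_mul_cancel_left₀ hgn])
  have dτ : HasDerivAt (fun s => τ (arc y b s)) (L b) 0 := by
    refine HasFDerivWithinAt.comp_hasDerivAt 0 ?_ harc hmemc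
    simpa using hτ
  have dproj : ∀ {c : ℝ → Ambient n} {c' : Ambient n}, HasDerivAt c c' 0 →
      HasDerivAt (fun s => c s (Fin.last n)) (c' (Fin.last n)) 0 := fun h =>
    ((EuclideanSpace.proj (𝕜 := ℝ) (Fin.last n)).hasFDerivAt).comp_hasDerivAt 0 h
  have dN : HasDerivAt (fun s => ‖sphereGrad f (arc y b s)‖ ^ 2) 0 0 := by
    have := dG.norm_sq
    rwa [arc_zero, inner_smul_right, ← hg, hgy, mul_zero, mul_zero] at this
  -- Each slot holding the gradient contributes `r³`, since the gradient has derivative `-r y` along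
  -- the arc while `H y = -g` and `H g = -r² y`.
  have dHg : HasDerivAt (fun s => inner ℝ (ambientHess f (arc y b s) (sphereGrad f (arc y b s)))
      (sphereGrad f (arc y b s))) (inner ℝ (ambientThird f y b g) g + 2 * r ^ 3) 0 := by
    have := (dH.clm_apply dG).inner ℝ dG
    refine this.congr_deriv ?_
    simp only [arc_zero, ← hg, ← hH, map_smul, map_neg, hself, hHg, inner_smul_left,
      inner_smul_right, inner_add_left, real_inner_self_eq_norm_sq, hy.1, neg_smul, inner_neg_left, inner_neg_right, conj_trivial]
    ring
  have hp : 0 < 1 + r ^ 2 := by positivity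
  have dsqrt : HasDerivAt (fun s => Real.sqrt (1 + ‖sphereGrad f (arc y b s)‖ ^ 2)) 0 0 := by
    have := (dN.const_add 1).sqrt (by rw [arc_zero]; exact hp.ne')
    simpa using this
  have dquot := dHg.fun_div (dN.const_add 1) (by rw [arc_zero]; exact hp.ne')
  have dR := ((dF.cosh.fun_add (dproj harc)).fun_mul ((hasDerivAt_trace dH).fun_sub dquot)).fun_sub
    (((dproj dG).fun_add (dF.sinh.fun_mul dN)).const_mul (n : ℝ))
  have dL := dτ.fun_mul dsqrt
  have hderiv := (dL.congr_of_eventuallyEq (f₁ := fun s => scaledRHS f (arc y b s))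
    (hmem.mono fun s hs => (heq _ hs).symm)).unique dR
  have hyg : inner ℝ y g = 0 := by rw [real_inner_comm, hgy]
  simp only [arc_zero, ← hg, ← hH, ← hr,
    hHg, inner_smul_left, hyg, mul_zero, add_zero, sub_zero, zero_div,
    PiLp.smul_apply, smul_eq_mul] at hderiv
  -- The ambient dimension is `n + 1`, and removing the directions `y` and `g` leaves `n - 1`.
  obtain ⟨K, hK1, hK2⟩ := trace_estimate (m := n - 1) (y := y) (g := g) (p := r ^ 2) (H := H)
    (A := ambientThird f y g) (by simp; omega) hy.1 hgy hg0 rfl hself hHg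
    (by rw [ambientThird_self hf hyc, ← hH, hHg, smul_smul]; congr 1; ring)
    (fun X hX hXy => by
      rw [inner_ambientThird hf hyc]
      exact inner_ambientThird_le_of_max hf hN hy hmax hX hXy)
  have hm : ((n - 1 : ℕ) : ℝ) = (n : ℝ) - 1 := by
    rw [Nat.cast_sub (by omega), Nat.cast_one]
  rw [hm] at hK1 hK2
  have hε : g (Fin.last n) ^ 2 ≤ (1 - y (Fin.last n) ^ 2) * r ^ 2 := by
    have h1 : inner ℝ (northPole n - y (Fin.last n) • y) g = g (Fin.last n) := by
      rw [inner_sub_left, inner_northPole, inner_smul_left, hyg]; simp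
    have h2 : ‖northPole n - y (Fin.last n) • y‖ ^ 2 = 1 - y (Fin.last n) ^ 2 := by
      rw [norm_sub_sq_real, inner_smul_right, inner_northPole, norm_northPole, norm_smul, hy.1,
        mul_one, Real.norm_eq_abs, sq_abs]
      ring
    rw [← h2, ← h1, ← mul_pow, sq_le_sq, abs_of_nonneg (a := _ * r) (by positivity)]
    exact abs_real_inner_le_norm _ _
  have hfinal := reaction_le (N := n) (by exact_mod_cast hn)
    (Real.one_le_cosh (radialExt f y)) (Real.sinh_sq _) hy.2 (last_le_one hy) (sq_nonneg r) hε hK1 hK2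
  have hLg : L g * Real.sqrt (1 + r ^ 2) = r * (L b * Real.sqrt (1 + r ^ 2)) := by
    conv_lhs => rw [hgb, map_smul, smul_eq_mul, mul_assoc]
  have hTg : ambientThird f y g = r • ambientThird f y b := by
    conv_lhs => rw [hgb, map_smul]
  have hgl : g (Fin.last n) = r * b (Fin.last n) := by
    conv_lhs => rw [hgb, PiLp.smul_apply, smul_eq_mul]
  rw [hTg, hgl] at hfinal
  simp only [ContinuousLinearMap.toLinearMap_smul, map_smul, smul_apply,
    inner_smul_left, conj_trivial, smul_eq_mul] at hfinal
  rw [hLg, hderiv]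
  refine le_of_eq_of_le ?_ hfinal
  field_simp
  ring

end Maximum

/-! ### The gradient estimates along the flow. -/

section Flow

variable {n : ℕ} {T : EReal} {γ : ℝ → Ambient n → ℝ}

lemma isOpen_openTimeInterval : IsOpen (openTimeInterval T) :=
  isOpen_Ioi.inter (isOpen_Iio.preimage continuous_coe_real_ereal)

lemma IsFlowSolution.contDiffOn_slice (h : IsFlowSolution n T γ) {t : ℝ}
    (ht : t ∈ openTimeInterval T) : ContDiffOn ℝ 3 (radialExt (γ t)) (cone n) :=
  h.contDiffOn.comp (contDiff_prodMk_right t).contDiffOn (fun _ hz => ⟨ht, hz⟩)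

lemma IsFlowSolution.sphereGrad_last (h : IsFlowSolution n T γ) {t : ℝ}
    (ht : t ∈ openTimeInterval T) {x : Ambient n} (hx : x ∈ hemisphere n)
    (hx0 : x (Fin.last n) = 0) : sphereGrad (γ t) x (Fin.last n) = 0 := by
  have := h.neumann t ht x hx hx0
  rwa [sinPhiDPhi, hx0, zero_smul, zero_sub, inner_neg_left, inner_northPole, neg_eq_zero] at this

/-- At a spatial maximum point, the time derivative of the squared length of the gradient is
controlled by the squared length of the gradient. -/
lemma IsFlowSolution.hasDerivAt_norm_sphereGrad_sq (h : IsFlowSolution n T γ) (hn : 2 ≤ n) {t : ℝ}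
    (ht : t ∈ openTimeInterval T) {y : Ambient n} (hy : y ∈ hemisphere n)
    (hmax : ∀ x ∈ hemisphere n, ‖sphereGrad (γ t) x‖ ^ 2 ≤ ‖sphereGrad (γ t) y‖ ^ 2) :
    ∃ d, HasDerivAt (fun s => ‖sphereGrad (γ s) y‖ ^ 2) d t ∧
      d * Real.sqrt (1 + ‖sphereGrad (γ t) y‖ ^ 2)
        ≤ -((((n : ℝ) - 1) + y (Fin.last n) * (n - 3)) * ‖sphereGrad (γ t) y‖ ^ 2) := by
  have hf := h.contDiffOn_slice ht
  have hmixed := fun (z : Ambient n) (hz : z ∈ cone n) =>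
    mixed_derivatives (F := fun s => radialExt (γ s)) isOpen_openTimeInterval uniqueDiffOn_cone
      cone_subset_closure_interior (h.contDiffOn.of_le (by norm_num)) ht hz
  obtain ⟨L, G, hL, hG, hGL⟩ := hmixed y (hemisphere_subset_cone hy)
  have hcont : ContinuousOn (fun x => deriv (fun s => radialExt (γ s) x) t) (cone n) := by
    intro z hz
    obtain ⟨L', _, hL', _⟩ := hmixed z hz
    exact hL'.continuousWithinAt
  have hgrad := continuousOn_sphereGrad (hf.of_le (by norm_num))
  -- The equation is assumed only in the open hemisphere; continuity extends it to the equator,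
  -- where the maximum may lie.
  have heq : EqOn (fun x => deriv (fun s => radialExt (γ s) x) t *
      Real.sqrt (1 + ‖sphereGrad (γ t) x‖ ^ 2)) (scaledRHS (γ t)) (hemisphere n) := by
    refine eqOn_hemisphere ?_ ((continuousOn_scaledRHS hf).mono hemisphere_subset_cone) ?_
    · refine (hcont.mul ?_).mono hemisphere_subset_cone
      exact (continuousOn_const.add (hgrad.norm.pow 2)).sqrt
    · intro x hx hx0
      have h1 : (fun s => radialExt (γ s) x) = fun s => γ s x :=
        funext fun s => radialExt_of_mem hx
      change deriv (fun s => radialExt (γ s) x) t * _ = _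
      rw [h1, h.equation t ht x hx hx0, flowRHS_mul_sqrt hf hx]
  have hle := time_deriv_le_of_max hn hf (fun x hx hx0 => h.sphereGrad_last ht hx hx0) hy hmax hL
    heq
  refine ⟨_, HasDerivAt.norm_sq hG, ?_⟩
  change 2 * inner ℝ (sphereGrad (γ t) y) G * _ ≤ _
  rw [real_inner_comm, hGL]
  linarith

lemma norm_sphereGrad_le_c1Norm {f : Ambient n → ℝ}
    (hf : ContinuousOn (sphereGrad f) (hemisphere n)) {y : Ambient n} (hy : y ∈ hemisphere n) :
    ‖sphereGrad f y‖ ≤ c1Norm f := by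
  have h1 : ‖sphereGrad f y‖ ≤ sSup ((fun y => ‖sphereGrad f y‖) '' hemisphere n) :=
    le_csSup (isCompact_hemisphere.image_of_continuousOn hf.norm).bddAbove ⟨y, hy, rfl⟩
  have h2 : 0 ≤ sSup ((fun y => |f y|) '' hemisphere n) := by
    refine Real.sSup_nonneg ?_
    rintro _ ⟨x, _, rfl⟩
    exact abs_nonneg _
  unfold c1Norm
  linarith

/-- If at spatial maximum points the squared length of the gradient decreases at rate `μ`, it
decays exponentially at this rate. -/
lemma IsFlowSolution.norm_sphereGrad_sq_le (h : IsFlowSolution n T γ) {μ : ℝ}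
    (hμ : ∀ t ∈ openTimeInterval T, ∀ y ∈ hemisphere n,
      (∀ x ∈ hemisphere n, ‖sphereGrad (γ t) x‖ ^ 2 ≤ ‖sphereGrad (γ t) y‖ ^ 2) →
      ∃ d, HasDerivAt (fun s => ‖sphereGrad (γ s) y‖ ^ 2) d t ∧
        d ≤ -μ * ‖sphereGrad (γ t) y‖ ^ 2) :
    ∀ t ∈ timeInterval T, ∀ y ∈ hemisphere n,
      ‖sphereGrad (γ t) y‖ ^ 2 ≤ c1Norm (γ 0) ^ 2 * Real.exp (-(μ * t)) := by
  refine max_principle (q := fun t y => ‖sphereGrad (γ t) y‖ ^ 2) isCompact_hemisphere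
    (h.continuousOn_grad.norm.pow 2) (fun x hx => ?_) hμ
  exact pow_le_pow_left₀ (norm_nonneg _) (norm_sphereGrad_le_c1Norm
    ((continuousOn_sphereGrad h.contDiffOn_zero).mono hemisphere_subset_cone) hx) 2

lemma IsFlowSolution.norm_sphereGrad_sq_le_c1Norm_sq (h : IsFlowSolution n T γ) (hn : 2 ≤ n) :
    ∀ t ∈ timeInterval T, ∀ y ∈ hemisphere n,
      ‖sphereGrad (γ t) y‖ ^ 2 ≤ c1Norm (γ 0) ^ 2 := by
  have := h.norm_sphereGrad_sq_le (μ := 0) fun t ht y hy hmax => by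
    obtain ⟨d, hd, hle⟩ := h.hasDerivAt_norm_sphereGrad_sq hn ht hy hmax
    refine ⟨d, hd, ?_⟩
    have hn' : (2 : ℝ) ≤ n := by exact_mod_cast hn
    have hcoef : 0 ≤ ((n : ℝ) - 1) + y (Fin.last n) * (n - 3) := by
      nlinarith [hy.2, last_le_one hy]
    have hv : 0 < Real.sqrt (1 + ‖sphereGrad (γ t) y‖ ^ 2) := Real.sqrt_pos.2 (by positivity)
    have h1 : d * Real.sqrt (1 + ‖sphereGrad (γ t) y‖ ^ 2) ≤ 0 :=
      hle.trans (neg_nonpos.2 (mul_nonneg hcoef (sq_nonneg _)))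
    simpa using nonpos_of_mul_nonpos_left h1 hv
  simpa using this

/-- The uniform bound is used first: it bounds `v` from above, which turns the estimate for `v p_t`
into a fixed decay rate. -/
lemma IsFlowSolution.norm_sphereGrad_sq_le_exp (h : IsFlowSolution n T γ) (hn : 3 ≤ n) :
    ∀ t ∈ timeInterval T, ∀ y ∈ hemisphere n,
      ‖sphereGrad (γ t) y‖ ^ 2 ≤ c1Norm (γ 0) ^ 2 *
        Real.exp (-(2 / Real.sqrt (1 + c1Norm (γ 0) ^ 2) * t)) := by
  refine h.norm_sphereGrad_sq_le fun t ht y hy hmax => ?_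
  obtain ⟨d, hd, hle⟩ := h.hasDerivAt_norm_sphereGrad_sq (by omega) ht hy hmax
  refine ⟨d, hd, ?_⟩
  have hC := h.norm_sphereGrad_sq_le_c1Norm_sq (by omega) t ⟨ht.1.le, ht.2⟩ y hy
  have hn' : (3 : ℝ) ≤ n := by exact_mod_cast hn
  have hcoef : 2 ≤ ((n : ℝ) - 1) + y (Fin.last n) * (n - 3) := by
    nlinarith [mul_nonneg hy.2 (sub_nonneg.2 hn')]
  set p := ‖sphereGrad (γ t) y‖ ^ 2
  have hp : 0 ≤ p := sq_nonneg _
  have hv : 0 < Real.sqrt (1 + p) := Real.sqrt_pos.2 (by positivity)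
  have hvV : Real.sqrt (1 + p) ≤ Real.sqrt (1 + c1Norm (γ 0) ^ 2) :=
    Real.sqrt_le_sqrt (by linarith)
  have h1 : d * Real.sqrt (1 + p) ≤ -(2 * p) :=
    hle.trans (neg_le_neg (mul_le_mul_of_nonneg_right hcoef hp))
  have h2 : d ≤ -(2 * p) / Real.sqrt (1 + p) := (le_div_iff₀ hv).2 h1
  have h3 : 2 * p / Real.sqrt (1 + c1Norm (γ 0) ^ 2) ≤ 2 * p / Real.sqrt (1 + p) :=
    div_le_div_of_nonneg_left (by positivity) hv hvV
  rw [neg_div] at h2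
  calc d ≤ -(2 * p / Real.sqrt (1 + c1Norm (γ 0) ^ 2)) := h2.trans (neg_le_neg h3)
    _ = _ := by ring

end Flow

end GuanLiFlow

theorem proposition3p2 (n : ℕ) (hn : 2 ≤ n) :
    (∃ C : ℝ → ℝ → ℝ, ∀ (T : EReal) (γ : ℝ → GuanLiFlow.Ambient n → ℝ),
      GuanLiFlow.IsFlowSolution n T γ →
        ∀ t ∈ GuanLiFlow.timeInterval T, ∀ y ∈ GuanLiFlow.hemisphere n,
          ‖GuanLiFlow.sphereGrad (γ t) y‖ ^ 2
            ≤ C (GuanLiFlow.c1Norm (γ 0)) (GuanLiFlow.minOn (γ 0))) ∧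
    (3 ≤ n → ∃ C₁ C₂ : ℝ → ℝ → ℝ, (∀ a b, 0 < C₂ a b) ∧
      ∀ (T : EReal) (γ : ℝ → GuanLiFlow.Ambient n → ℝ),
        GuanLiFlow.IsFlowSolution n T γ →
          ∀ t ∈ GuanLiFlow.timeInterval T, ∀ y ∈ GuanLiFlow.hemisphere n,
            ‖GuanLiFlow.sphereGrad (γ t) y‖ ^ 2
              ≤ C₁ (GuanLiFlow.c1Norm (γ 0)) (GuanLiFlow.minOn (γ 0)) *
                Real.exp (-(C₂ (GuanLiFlow.c1Norm (γ 0)) (GuanLiFlow.minOn (γ 0)) * t))) := by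
  refine ⟨⟨fun a _ => a ^ 2, fun T γ h => h.norm_sphereGrad_sq_le_c1Norm_sq hn⟩, fun hn3 =>
    ⟨fun a _ => a ^ 2, fun a _ => 2 / Real.sqrt (1 + a ^ 2), fun a _ => by positivity,
      fun T γ h => h.norm_sphereGrad_sq_le_exp hn3⟩⟩
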